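/- Let $\Omega>0$ and let $F:\mathbb R\to\mathbb R$ be $\Omega$-bandlimited with spectral measure $\mu$, that is, $F(x)=\frac1{2\pi}\int e^{i\omega x}\,d\mu(\omega)$ for all $x\in\mathbb R$, where $\mu$ is a signed (or, more generally, complex) Borel measure on $\mathbb R$ of finite total variation $|\mu|$ supported on $[-\Omega,\Omega]$. Let $f:[0,1]\to\mathbb R$ be the restriction of $F$ to $[0,1]$. For $N\ge 1$ let $c_N^\alpha=\frac{\cos(\pi\alpha/N)+1}{2}$, $\alpha=0,\dots,N$, be the Chebyshev–Lobatto grid on $[0,1]$, let $P_N^\alpha$ be the corresponding Lagrange basis polynomials, and for an integer $m\ge 0$ put $$E_{m,N}[f]=\max_{u\in[0,1-2^{-m}],\ v\in[0,1]}\Big|f(u+2^{-m}v)-\sum_{\alpha=0}^N f(u+2^{-m}c_N^\alpha)\,P_N^\alpha(v)\Big| .$$ Then for all integers $m\ge 0$ and $N\ge 1$ this maximum exists and $$E_{m,N}[f]\le\frac{2|\mu|}{\pi}\,e^{\frac12(2^{-m}\Omega-N)} .$$ Moreover, for $K>m$ let $T:\{0,1\}^K\to\mathbb R$, $T(\sigma_1,\dots,\sigma_K)=f\big(\sum_{k=1}^K2^{-k}\sigma_k\big)$,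 be the quantized tensor representation of $f$ at depth $K$, and for $\varepsilon>0$ let $r_m^{(\varepsilon,\infty)}[T]$ be the smallest integer $r\ge 0$ for which there are $T_L^\alpha:\{0,1\}^m\to\mathbb R$ and $T_R^\alpha:\{0,1\}^{K-m}\to\mathbb R$, $\alpha=0,\dots,r-1$, with $$\max_{\sigma\in\{0,1\}^K}\Big|T(\sigma_1,\dots,\sigma_K)-\sum_{\alpha=0}^{r-1}T_L^\alpha(\sigma_1,\dots,\sigma_m)\,T_R^\alpha(\sigma_{m+1},\dots,\sigma_K)\Big|\le\varepsilon .$$ Then, with $\log_+x=\max(0,\log x)$ and $\log_+0=0$, $$r_m^{(\varepsilon,\infty)}[T]\le 1+\Big\lceil 2^{-m}\Omega+2\log_+\Big(\frac{2|\mu|}{\pi\varepsilon}\Big)\Big\rceil .$$ -/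

import Mathlib

open MeasureTheory
open scoped Real

noncomputable section

/-- The total variation `|μ|` of a complex measure on the line, as a real number. -/
def totalVariationNorm (μ : ComplexMeasure ℝ) : ℝ := (μ.variation Set.univ).toReal

/-- `F : ℝ → ℝ` is `Ω`-bandlimited with spectral measure `μ`: the measure `μ` has finite total
variation, is supported on `[-Ω, Ω]`, and `F x = (1 / 2π) ∫ e^{iωx} dμ(ω)` for all real `x`. -/
structure IsBandlimitedWith (Ω : ℝ) (F : ℝ → ℝ) (μ : ComplexMeasure ℝ) : Prop where
  bandwidth_pos : 0 < Ω
  finite_variation : μ.variation Set.univ < ⊤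
  support : ∀ S : Set ℝ, MeasurableSet S → Disjoint S (Set.Icc (-Ω) Ω) → μ S = 0
  eq_integral : ∀ x : ℝ, (F x : ℂ) =
    1 / (2 * π) * μ.integral (fun ω : ℝ => Complex.exp (Complex.I * ω * x))
      (ContinuousLinearMap.mul ℝ ℂ)

/-- The Chebyshev-Lobatto grid points `c_N^α`, `α = 0, …, N`, in `[0, 1]` (for `N ≥ 1`). -/
def chebNode (N : ℕ) (α : Fin (N + 1)) : ℝ := (Real.cos (π * (α : ℕ) / N) + 1) / 2

/-- The Lagrange basis polynomials `P_N^α` of the Chebyshev-Lobatto grid. -/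
def chebCardinal (N : ℕ) (α : Fin (N + 1)) : Polynomial ℝ :=
  Lagrange.basis Finset.univ (chebNode N) α

/-- The set of all values
`|f (u + 2^{-m} v) - ∑ α, f (u + 2^{-m} c_N^α) P_N^α(v)|`, `u ∈ [0, 1 - 2^{-m}]`, `v ∈ [0, 1]`. -/
def interpErrorSet (m N : ℕ) (f : ℝ → ℝ) : Set ℝ :=
  {e | ∃ u ∈ Set.Icc (0 : ℝ) (1 - 1 / 2 ^ m), ∃ v ∈ Set.Icc (0 : ℝ) 1,
    e = |f (u + v / 2 ^ m) -
      ∑ α : Fin (N + 1), f (u + chebNode N α / 2 ^ m) * (chebCardinal N α).eval v|}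

/-- The interpolation error `E_{m,N}[f]`, the largest element of `interpErrorSet m N f`.
Only the values of `f` on `[0, 1]` enter. -/
def interpError (m N : ℕ) (f : ℝ → ℝ) : ℝ := sSup (interpErrorSet m N f)

/-- Tensors with `K` binary indices. The norm on this type is the maximum norm `‖·‖_∞`. -/
abbrev BinTensor (K : ℕ) : Type := (Fin K → Fin 2) → ℝ

/-- The dyadic point `x = ∑_{k=1}^K 2^{-k} σ_k`. -/
def dyadicPoint {K : ℕ} (σ : Fin K → Fin 2) : ℝ :=
  ∑ k : Fin K, ((σ k : ℕ) : ℝ) / 2 ^ ((k : ℕ) + 1)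

/-- The quantized tensor representation of `f` on the dyadic grid of depth `K`. -/
def quantizedTensor (K : ℕ) (f : ℝ → ℝ) : BinTensor K := fun σ => f (dyadicPoint σ)

/-- The tensor product of `L`, carrying the first `m` indices, and `R`, carrying the last `K - m`. -/
def splitTensorProduct {m K : ℕ} (hm : m ≤ K) (L : BinTensor m) (R : BinTensor (K - m)) :
    BinTensor K :=
  fun σ => L (fun i => σ (Fin.castLE hm i)) *
    R (fun j => σ ⟨m + (j : ℕ), by have := j.isLt; omega⟩)

/-- The numbers of terms `r` for which `T` is within `ε`, in the maximum norm, of a sum of `r`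
tensor products split after the first `m` indices. -/
def unfoldingApproxRanks {m K : ℕ} (hm : m ≤ K) (ε : ℝ) (T : BinTensor K) : Set ℕ :=
  {r | ∃ (L : Fin r → BinTensor m) (R : Fin r → BinTensor (K - m)),
    ‖T - ∑ α : Fin r, splitTensorProduct hm (L α) (R α)‖ ≤ ε}

/-- The `(ε, ∞)` rank `r_m^{(ε,∞)}[T]` of the `m`-th unfolding matrix of `T`. -/
def unfoldingRank {m K : ℕ} (hm : m ≤ K) (ε : ℝ) (T : BinTensor K) : ℕ :=
  sInf (unfoldingApproxRanks hm ε T)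

end

/-!
The error of interpolating a smooth `g` at `N + 1` nodes is `g⁽ᴺ⁺¹⁾(ξ) / (N + 1)!` times the nodal
polynomial (`abs_sub_lagrange_le`, from a generalized Rolle theorem). For the Chebyshev–Lobatto
grid on `[0, 1]` the nodal polynomial is a multiple of `(x² - 1) U_{N-1}(x)`, `x = 2v - 1`, which
at `x = cos θ` equals `- sin θ sin (Nθ)`; hence it is at most `4⁻ᴺ` in absolute value
(`abs_prod_sub_chebNode_le`).

For `g v = cos (a v + φ)` with `|a| ≤ A = 2⁻ᵐ Ω` this bounds the error
by `A ^ (N + 1) / (N + 1)! / 4 ^ N`, and since `(A / 2) ^ (N + 1) / (N + 1)! ≤ e ^ (A / 2)` and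
`√e ≤ 2`, it is at most `4 e ^ ((A - N) / 2)`. Rotating the phase carries the bound over to the
plane waves `e ^ (iωx)`, `|ω| ≤ Ω` (`norm_cexp_sub_cheb_le`). A bandlimited function is a
superposition of these, with weight `|μ| / 2π`, which yields the factor `2 |μ| / π`
(`IsBandlimitedWith.abs_sub_cheb_le`). The maximum exists because the error is continuous on a
compact set.

For the ranks, the first `m` digits of a dyadic point give `u ∈ [0, 1 - 2⁻ᵐ]` and the remaining
ones give `v ∈ [0, 1]`, so the interpolation formula is itself a sum of `N + 1` tensor products
(`succ_mem_unfoldingApproxRanks`). With `N = ⌈A + 2 log⁺ (2 |μ| / (π ε))⌉ ≥ 1` the error is at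
most `ε`.
-/

/-! ### The remainder of Lagrange interpolation -/

/-- Generalized Rolle theorem: the zeros are listed increasingly, and each step of the induction
replaces them by zeros of the derivative between consecutive ones. -/
lemma exists_iteratedDeriv_eq_zero (n : ℕ) (g : ℝ → ℝ) (hg : ContDiff ℝ n g)
    (z : Fin (n + 1) → ℝ) (hz : StrictMono z) (h0 : ∀ i, g (z i) = 0) :
    ∃ ξ, iteratedDeriv n g ξ = 0 := by
  induction n generalizing g with
  | zero => exact ⟨z 0, by simpa using h0 0⟩
  | succ n ih =>
    have hstep : ∀ i : Fin (n + 1),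
        ∃ c ∈ Set.Ioo (z i.castSucc) (z i.succ), deriv g c = 0 := fun i =>
      exists_deriv_eq_zero (hz i.castSucc_lt_succ) hg.continuous.continuousOn
        (by rw [h0, h0])
    choose w hw hw0 using hstep
    have hd : ContDiff ℝ n (deriv g) :=
      ((contDiff_succ_iff_deriv (n := n)).1 (by exact_mod_cast hg)).2.2
    have hmono : StrictMono w := by
      refine Fin.strictMono_iff_lt_succ.2 fun i => ?_
      have h1 := (hw i.castSucc).2
      have h2 := (hw i.succ).1
      rw [← Fin.castSucc_succ] at h1
      exact h1.trans h2
    obtain ⟨ξ, hξ⟩ := ih (deriv g) hd w hmono hw0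
    exact ⟨ξ, by rw [iteratedDeriv_succ', hξ]⟩

lemma iteratedDeriv_polynomial_eval (n : ℕ) (p : Polynomial ℝ) :
    iteratedDeriv n (fun x => p.eval x) = fun x => (Polynomial.derivative^[n] p).eval x := by
  induction n generalizing p with
  | zero => simp
  | succ n ih =>
    rw [iteratedDeriv_succ', Function.iterate_succ_apply, ← ih]
    congr 1
    ext x
    simp

/-- The remainder estimate for Lagrange interpolation of a function with a globally bounded
derivative of order `N + 1`. -/
theorem abs_sub_lagrange_le {N : ℕ} (y : Fin (N + 1) → ℝ) (hy : Function.Injective y)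
    (g : ℝ → ℝ) (hg : ContDiff ℝ (N + 1 : ℕ) g) (M : ℝ)
    (hM : ∀ t, |iteratedDeriv (N + 1) g t| ≤ M) (x : ℝ) :
    |g x - ∑ i, g (y i) * (Lagrange.basis Finset.univ y i).eval x| ≤
      M / (N + 1).factorial * |∏ i, (x - y i)| := by
  have hinj : Set.InjOn y (Finset.univ : Finset (Fin (N + 1))) := hy.injOn
  set p := Lagrange.interpolate Finset.univ y (fun i => g (y i)) with hp
  set W := Lagrange.nodal Finset.univ y with hW
  have hpx : ∑ i, g (y i) * (Lagrange.basis Finset.univ y i).eval x = p.eval x := by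
    simp [hp, Lagrange.interpolate_apply, Polynomial.eval_finsetSum]
  rw [hpx, ← Lagrange.eval_nodal, ← hW]
  have hpy : ∀ i, p.eval (y i) = g (y i) := fun i =>
    Lagrange.eval_interpolate_at_node (fun i => g (y i)) hinj (Finset.mem_univ i)
  have hWy : ∀ i, W.eval (y i) = 0 := fun i => Lagrange.eval_nodal_at_node (Finset.mem_univ i)
  by_cases hx : ∃ i, x = y i
  · obtain ⟨i, rfl⟩ := hx
    simp [hpy, hWy]
  push Not at hx
  have hWx : W.eval x ≠ 0 := Lagrange.eval_nodal_not_at_node fun i _ => hx i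
  -- Subtracting this multiple of the nodal polynomial makes `x` a further zero of the error.
  set c := (g x - p.eval x) / W.eval x with hc
  set q := p + Polynomial.C c * W with hq
  have hq' : Polynomial.derivative^[N + 1] q = Polynomial.C (c * (N + 1).factorial) := by
    have hdeg : W.natDegree = N + 1 := by simp [hW]
    have hmon : W.Monic := Lagrange.nodal_monic
    have hpd : p.degree < (N + 1 : ℕ) := by
      have h := Lagrange.degree_interpolate_lt (fun i => g (y i)) hinj
      rwa [Finset.card_univ, Fintype.card_fin] at h
    have hp0 : Polynomial.derivative^[N + 1] p = 0 :=
      Polynomial.iterate_derivative_eq_zero_of_degree_lt hpd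
    have hWd : Polynomial.derivative^[N + 1] W = Polynomial.C ((N + 1).factorial : ℝ) := by
      have h0 : (Polynomial.derivative^[N + 1] W).natDegree ≤ 0 :=
        (Polynomial.natDegree_iterate_derivative W (N + 1)).trans (by omega)
      rw [Polynomial.eq_C_of_natDegree_le_zero h0, Polynomial.coeff_iterate_derivative]
      have h1 : W.coeff (N + 1) = 1 := by rw [← hdeg]; exact hmon
      rw [zero_add, h1, Nat.descFactorial_self, nsmul_eq_mul, mul_one]
    rw [hq, iterate_map_add, hp0, Polynomial.iterate_derivative_C_mul, hWd, zero_add,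
      Polynomial.C_mul]
  have hqc : ContDiff ℝ (N + 1 : ℕ) (fun t => q.eval t) := by
    simpa using q.contDiff_aeval (𝕜 := ℝ) (N + 1 : ℕ)
  have hxs : x ∉ Finset.univ.image y := by
    simpa using fun i => (hx i).symm
  set Z := insert x (Finset.univ.image y) with hZ
  have hcard : Z.card = N + 1 + 1 := by
    rw [hZ, Finset.card_insert_of_notMem hxs, Finset.card_image_of_injective _ hy]
    simp
  have hzero : ∀ t ∈ Z, g t - q.eval t = 0 := by
    intro t ht
    rw [hZ, Finset.mem_insert, Finset.mem_image] at ht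
    rcases ht with rfl | ⟨i, -, rfl⟩
    · simp only [hq, Polynomial.eval_add, Polynomial.eval_mul, Polynomial.eval_C, hc]
      field_simp
      ring
    · simp [hq, hpy, hWy]
  obtain ⟨ξ, hξ⟩ := exists_iteratedDeriv_eq_zero (N + 1) (fun t => g t - q.eval t)
    (hg.sub hqc) (Z.orderEmbOfFin hcard) (Z.orderEmbOfFin hcard).strictMono
    (fun i => hzero _ (Finset.orderEmbOfFin_mem Z hcard i))
  rw [iteratedDeriv_fun_sub hg.contDiffAt hqc.contDiffAt, iteratedDeriv_polynomial_eval,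
    hq', sub_eq_zero] at hξ
  simp only [Polynomial.eval_C] at hξ
  have hfac : (0 : ℝ) < (N + 1).factorial := by positivity
  have hgx : g x - p.eval x = c * W.eval x := by rw [hc]; field_simp
  have hcM : |c| ≤ M / (N + 1).factorial := by
    rw [le_div_iff₀ hfac]
    have := hM ξ
    rwa [hξ, abs_mul, abs_of_pos hfac] at this
  rw [hgx, abs_mul]
  gcongr

/-! ### The nodal polynomial of the Chebyshev–Lobatto grid -/

lemma injective_cos_lobatto {N : ℕ} (hN : 1 ≤ N) :
    Function.Injective fun α : Fin (N + 1) => Real.cos (π * (α : ℕ) / N) := by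
  have hN' : (0 : ℝ) < N := by exact_mod_cast hN
  have hmem : ∀ α : Fin (N + 1), π * (α : ℕ) / N ∈ Set.Icc 0 π := fun α => by
    refine ⟨by positivity, ?_⟩
    rw [div_le_iff₀ hN']
    have : ((α : ℕ) : ℝ) ≤ N := by exact_mod_cast Nat.lt_succ_iff.1 α.isLt
    gcongr
  intro α β h
  have h' := Real.injOn_cos (hmem α) (hmem β) h
  have hpi := Real.pi_ne_zero
  field_simp at h'
  exact Fin.ext (by exact_mod_cast h')

lemma injective_chebNode {N : ℕ} (hN : 1 ≤ N) : Function.Injective (chebNode N) := by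
  intro α β h
  refine injective_cos_lobatto hN ?_
  simp only [chebNode] at h
  dsimp only
  linarith

lemma chebNode_mem_Icc (N : ℕ) (α : Fin (N + 1)) : chebNode N α ∈ Set.Icc (0 : ℝ) 1 := by
  have h1 := Real.neg_one_le_cos (π * (α : ℕ) / N)
  have h2 := Real.cos_le_one (π * (α : ℕ) / N)
  constructor <;> simp only [chebNode] <;> linarith

open Polynomial in
/-- Up to a factor, the nodal polynomial of the Lobatto points on `[-1, 1]` is
`(X² - 1) U_{N-1}`. -/
lemma two_pow_mul_nodal_lobatto (n : ℕ) :
    C ((2 : ℝ) ^ n) *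
      Lagrange.nodal Finset.univ (fun α : Fin (n + 1 + 1) =>
        Real.cos (π * (α : ℕ) / (n + 1 : ℕ))) =
      (X ^ 2 - C 1) * Chebyshev.U ℝ n := by
  have h2 : (2 : ℝ) ^ n ≠ 0 := by positivity
  have hd2 : (X ^ 2 - C (1 : ℝ)).degree = 2 := degree_X_pow_sub_C (by norm_num) 1
  have hdl : (C ((2 : ℝ) ^ n) *
      Lagrange.nodal Finset.univ (fun α : Fin (n + 1 + 1) =>
        Real.cos (π * (α : ℕ) / (n + 1 : ℕ)))).degree = (n + 2 : ℕ) := by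
    rw [degree_C_mul h2, Lagrange.degree_nodal, Finset.card_univ, Fintype.card_fin]
  refine Polynomial.eq_of_degree_le_of_eval_index_eq Finset.univ
    (injective_cos_lobatto (N := n + 1) (by omega)).injOn ?_ ?_ ?_ ?_
  · rw [hdl, Finset.card_univ, Fintype.card_fin]
  · rw [hdl, degree_mul, hd2, Chebyshev.degree_U_natCast]
    push_cast
    rw [add_comm]
  · rw [leadingCoeff_mul, leadingCoeff_C, Lagrange.nodal_monic.leadingCoeff, leadingCoeff_mul,
      (monic_X_pow_sub_C (1 : ℝ) (by norm_num : 2 ≠ 0)).leadingCoeff,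
      Chebyshev.leadingCoeff_U_natCast]
    ring
  · intro α _
    have h0 := Lagrange.eval_nodal_at_node (Finset.mem_univ α)
      (v := fun α : Fin (n + 1 + 1) => Real.cos (π * (α : ℕ) / (n + 1 : ℕ)))
    rw [eval_mul, h0, mul_zero, eval_mul]
    set θ := π * (α : ℕ) / (n + 1 : ℕ) with hθ
    have hU := Polynomial.Chebyshev.U_real_cos θ n
    have hs : Real.sin (((n : ℤ) + 1 : ℝ) * θ) = 0 := by
      have : ((n : ℤ) + 1 : ℝ) * θ = (α : ℕ) * π := by
        rw [hθ]; push_cast; field_simp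
      rw [this, Real.sin_nat_mul_pi]
    rw [hs] at hU
    have hsq := Real.sin_sq_add_cos_sq θ
    simp only [eval_sub, eval_pow, eval_X, eval_C]
    linear_combination Real.sin θ * hU - (Chebyshev.U ℝ n).eval (Real.cos θ) * hsq

/-- With `x = 2v - 1 = cos θ` the nodal polynomial of the grid is `-4⁻ᴺ sin θ sin (Nθ)`. -/
theorem abs_prod_sub_chebNode_le {N : ℕ} (hN : 1 ≤ N) {v : ℝ} (hv : v ∈ Set.Icc (0 : ℝ) 1) :
    |∏ α, (v - chebNode N α)| ≤ 1 / 4 ^ N := by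
  obtain ⟨n, rfl⟩ : ∃ n, N = n + 1 := ⟨N - 1, by omega⟩
  set θ := Real.arccos (2 * v - 1) with hθ
  have hc : Real.cos θ = 2 * v - 1 :=
    Real.cos_arccos (by linarith [hv.1]) (by linarith [hv.2])
  have hprod : ∏ α, (v - chebNode (n + 1) α) =
      (∏ α : Fin (n + 1 + 1), (Real.cos θ - Real.cos (π * (α : ℕ) / (n + 1 : ℕ)))) /
        2 ^ (n + 2) := by
    have h2 : ((2 : ℝ) ^ (n + 2)) = ∏ _α : Fin (n + 1 + 1), (2 : ℝ) := by simp
    rw [h2, ← Finset.prod_div_distrib]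
    refine Finset.prod_congr rfl fun α _ => ?_
    rw [chebNode, hc]
    ring
  have hnod := congrArg (Polynomial.eval (Real.cos θ)) (two_pow_mul_nodal_lobatto n)
  rw [Polynomial.eval_mul, Lagrange.eval_nodal] at hnod
  simp only [Polynomial.eval_mul, Polynomial.eval_sub, Polynomial.eval_pow, Polynomial.eval_X,
    Polynomial.eval_C] at hnod
  have hU := Polynomial.Chebyshev.U_real_cos θ n
  have hsq := Real.sin_sq_add_cos_sq θ
  have hval : 2 ^ n * ∏ α : Fin (n + 1 + 1),
      (Real.cos θ - Real.cos (π * (α : ℕ) / (n + 1 : ℕ))) =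
      -(Real.sin θ * Real.sin (((n : ℤ) + 1 : ℝ) * θ)) := by
    linear_combination hnod + (-Real.sin θ) * hU +
      (Polynomial.Chebyshev.U ℝ n).eval (Real.cos θ) * hsq
  have hle : |Real.sin θ * Real.sin (((n : ℤ) + 1 : ℝ) * θ)| ≤ 1 := by
    rw [abs_mul]
    exact mul_le_one₀ (Real.abs_sin_le_one _) (abs_nonneg _) (Real.abs_sin_le_one _)
  have h4 : ∏ α, (v - chebNode (n + 1) α) =
      -(Real.sin θ * Real.sin (((n : ℤ) + 1 : ℝ) * θ)) / 4 ^ (n + 1) := by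
    rw [hprod, ← hval]
    have : (4 : ℝ) ^ (n + 1) = 2 ^ n * 2 ^ (n + 2) := by
      rw [← pow_add, show (4 : ℝ) = 2 ^ 2 by norm_num, ← pow_mul]; congr 1; ring
    rw [this]
    field_simp
  rw [h4, abs_div, abs_neg, abs_of_pos (by positivity : (0 : ℝ) < 4 ^ (n + 1))]
  gcongr

/-! ### Interpolation of plane waves -/

lemma abs_iteratedDeriv_cos_mul_add_le (n : ℕ) (a φ t : ℝ) :
    |iteratedDeriv n (fun t => Real.cos (a * t + φ)) t| ≤ |a| ^ n := by
  have h := iteratedDeriv_comp_const_mul (n := n) (f := fun s => Real.cos (s + φ))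
    (by fun_prop) a
  rw [h, iteratedDeriv_comp_add_const]
  simp only [abs_mul, abs_pow]
  exact mul_le_of_le_one_right (by positivity) (Real.abs_iteratedDeriv_cos_le_one _ _)

/-- The remainder bound decays exponentially because
`(a / 2) ^ (N + 1) / (N + 1)! ≤ e ^ (a / 2)` and `√e ≤ 2`. -/
lemma pow_div_factorial_div_four_pow_le (N : ℕ) {a : ℝ} (ha : 0 ≤ a) :
    a ^ (N + 1) / (N + 1).factorial * (1 / 4 ^ N) ≤ 4 * Real.exp ((a - N) / 2) := by
  have h1 := Real.pow_div_factorial_le_exp (x := a / 2) (by positivity) (N + 1)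
  have hhalf : Real.exp (1 / 2) ≤ 2 := by
    have h := Real.exp_one_lt_d9
    have hsq : Real.exp (1 / 2) ^ 2 = Real.exp 1 := by
      rw [← Real.exp_nat_mul]; norm_num
    nlinarith [Real.exp_pos (1 / 2)]
  have h2 : (1 / 2 : ℝ) ^ N ≤ Real.exp (-(N / 2)) := by
    rw [Real.exp_neg, one_div, inv_pow]
    have : Real.exp (N / 2 : ℝ) = Real.exp (1 / 2) ^ N := by
      rw [← Real.exp_nat_mul]; congr 1; ring
    rw [this]
    gcongr
  have h4 : (4 : ℝ) ^ N = 2 ^ N * 2 ^ N := by rw [← mul_pow]; norm_num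
  calc a ^ (N + 1) / (N + 1).factorial * (1 / 4 ^ N)
      = 2 * ((a / 2) ^ (N + 1) / (N + 1).factorial * (1 / 2) ^ N) := by
        rw [div_pow, div_pow, one_pow, h4, pow_succ (2 : ℝ)]
        field_simp
    _ ≤ 2 * (Real.exp (a / 2) * Real.exp (-(N / 2))) := by gcongr
    _ = 2 * Real.exp ((a - N) / 2) := by rw [← Real.exp_add]; congr 2; ring
    _ ≤ 4 * Real.exp ((a - N) / 2) := by
        have := Real.exp_pos ((a - N) / 2)
        linarith

lemma abs_cos_sub_cheb_le {N : ℕ} (hN : 1 ≤ N) {a A : ℝ} (ha : |a| ≤ A) (φ : ℝ) {v : ℝ}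
    (hv : v ∈ Set.Icc (0 : ℝ) 1) :
    |Real.cos (a * v + φ) -
      ∑ α, Real.cos (a * chebNode N α + φ) * (chebCardinal N α).eval v| ≤
      4 * Real.exp ((A - N) / 2) := by
  have h := abs_sub_lagrange_le (chebNode N) (injective_chebNode hN)
    (fun t => Real.cos (a * t + φ)) (by fun_prop) (|a| ^ (N + 1))
    (fun t => abs_iteratedDeriv_cos_mul_add_le _ a φ t) v
  calc _ ≤ |a| ^ (N + 1) / (N + 1).factorial * |∏ α, (v - chebNode N α)| := h
    _ ≤ |a| ^ (N + 1) / (N + 1).factorial * (1 / 4 ^ N) := by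
        gcongr
        exact abs_prod_sub_chebNode_le hN hv
    _ ≤ 4 * Real.exp ((|a| - N) / 2) := pow_div_factorial_div_four_pow_le N (abs_nonneg a)
    _ ≤ 4 * Real.exp ((A - N) / 2) := by gcongr

/-- The interpolation error of a plane wave on the cell `u + [0, 2⁻ᵐ]`. Multiplying the complex
error by a unimodular constant makes it real, and its real part is the error of a cosine. -/
theorem norm_cexp_sub_cheb_le {m N : ℕ} (hN : 1 ≤ N) {Ω ω : ℝ} (hω : |ω| ≤ Ω) (u : ℝ) {v : ℝ}
    (hv : v ∈ Set.Icc (0 : ℝ) 1) :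
    ‖Complex.exp (Complex.I * ω * (u + v / 2 ^ m : ℝ)) -
      ∑ α, (chebCardinal N α).eval v •
        Complex.exp (Complex.I * ω * (u + chebNode N α / 2 ^ m : ℝ))‖ ≤
      4 * Real.exp ((Ω / 2 ^ m - N) / 2) := by
  set E := Complex.exp (Complex.I * ω * (u + v / 2 ^ m : ℝ)) -
      ∑ α, (chebCardinal N α).eval v •
        Complex.exp (Complex.I * ω * (u + chebNode N α / 2 ^ m : ℝ)) with hE
  set ψ := Complex.arg E
  have hrot : (‖E‖ : ℂ) = Complex.exp (-(ψ * Complex.I)) * E := by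
    conv_rhs => rw [← Complex.norm_mul_exp_arg_mul_I E]
    rw [mul_left_comm, ← Complex.exp_add]
    simp [ψ]
  have hre : ∀ t : ℝ, (Complex.exp (-(ψ * Complex.I)) *
      Complex.exp (Complex.I * ω * (u + t / 2 ^ m : ℝ))).re =
      Real.cos (ω / 2 ^ m * t + (ω * u - ψ)) := by
    intro t
    rw [← Complex.exp_add, show -(ψ * Complex.I) + Complex.I * ω * (u + t / 2 ^ m : ℝ) =
      ((ω / 2 ^ m * t + (ω * u - ψ) : ℝ) : ℂ) * Complex.I by push_cast; ring,
      Complex.exp_ofReal_mul_I_re]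
  have hnorm : ‖E‖ = Real.cos (ω / 2 ^ m * v + (ω * u - ψ)) -
      ∑ α, Real.cos (ω / 2 ^ m * chebNode N α + (ω * u - ψ)) * (chebCardinal N α).eval v := by
    have h := congrArg Complex.re hrot
    rw [Complex.ofReal_re] at h
    rw [h, hE, mul_sub, Complex.sub_re, hre, Finset.mul_sum, Complex.re_sum]
    congr 1
    refine Finset.sum_congr rfl fun α _ => ?_
    rw [mul_smul_comm, Complex.smul_re, hre, smul_eq_mul, mul_comm]
  have ha : |ω / 2 ^ m| ≤ Ω / 2 ^ m := by
    rw [abs_div, abs_of_pos (by positivity : (0 : ℝ) < 2 ^ m)]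
    gcongr
  rw [hnorm]
  exact (le_abs_self _).trans (abs_cos_sub_cheb_le hN ha _ hv)

/-! ### Bandlimited functions -/

lemma norm_cexp_I_mul_mul (ω x : ℝ) : ‖Complex.exp (Complex.I * ω * x)‖ = 1 := by
  rw [show Complex.I * ω * x = ((ω * x : ℝ) : ℂ) * Complex.I by push_cast; ring,
    Complex.norm_exp_ofReal_mul_I]

namespace IsBandlimitedWith

variable {Ω : ℝ} {F : ℝ → ℝ} {μ : ComplexMeasure ℝ}

lemma isFiniteMeasure (hF : IsBandlimitedWith Ω F μ) : IsFiniteMeasure μ.variation :=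
  ⟨hF.finite_variation⟩

lemma ae_abs_le (hF : IsBandlimitedWith Ω F μ) : ∀ᵐ ω ∂μ.variation, |ω| ≤ Ω := by
  have h0 : μ.variation (Set.Icc (-Ω) Ω)ᶜ = 0 :=
    (VectorMeasure.variation_apply_eq_zero measurableSet_Icc.compl).2 fun t ht htm =>
      hF.support t htm (Set.disjoint_left.2 fun _ hx => ht hx)
  filter_upwards [mem_ae_iff.2 h0] with ω hω
  exact abs_le.2 hω

lemma integrable_cexp (hF : IsBandlimitedWith Ω F μ) (x : ℝ) :
    Integrable (fun ω : ℝ => Complex.exp (Complex.I * ω * x)) μ.variation := by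
  have := hF.isFiniteMeasure
  refine Integrable.of_bound (C := 1) ?_ (ae_of_all _ fun ω => (norm_cexp_I_mul_mul ω x).le)
  exact Continuous.aestronglyMeasurable (by fun_prop)

lemma continuous (hF : IsBandlimitedWith Ω F μ) : Continuous F := by
  have := hF.isFiniteMeasure
  have hint : Continuous fun x : ℝ =>
      μ.integral (fun ω : ℝ => Complex.exp (Complex.I * ω * x)) (ContinuousLinearMap.mul ℝ ℂ) := by
    refine VectorMeasure.continuous_of_dominated (bound := fun _ => 1)
      (fun x => (hF.integrable_cexp x).aestronglyMeasurable)
      (fun x => ae_of_all _ fun ω => (norm_cexp_I_mul_mul ω x).le) (integrable_const _)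
      (ae_of_all _ fun ω => by fun_prop)
  have hre : F = fun x : ℝ => (1 / (2 * π) * μ.integral (fun ω : ℝ =>
      Complex.exp (Complex.I * ω * x)) (ContinuousLinearMap.mul ℝ ℂ)).re := by
    ext x
    rw [← hF.eq_integral x, Complex.ofReal_re]
  rw [hre]
  exact Complex.continuous_re.comp (continuous_const.mul hint)

/-- Interpolation is linear, so the error for `F` is the integral of the errors for the plane
waves against the spectral measure. -/
theorem abs_sub_cheb_le (hF : IsBandlimitedWith Ω F μ) {m N : ℕ} (hN : 1 ≤ N) (u : ℝ) {v : ℝ}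
    (hv : v ∈ Set.Icc (0 : ℝ) 1) :
    |F (u + v / 2 ^ m) - ∑ α, F (u + chebNode N α / 2 ^ m) * (chebCardinal N α).eval v| ≤
      2 * totalVariationNorm μ / π * Real.exp ((Ω / 2 ^ m - N) / 2) := by
  have := hF.isFiniteMeasure
  set B := ContinuousLinearMap.mul ℝ ℂ
  set C := 4 * Real.exp ((Ω / 2 ^ m - N) / 2) with hC
  have hB : ‖B‖ ≤ 1 := ContinuousLinearMap.opNorm_mul_le ℝ ℂ
  have heq : ((F (u + v / 2 ^ m) -
      ∑ α, F (u + chebNode N α / 2 ^ m) * (chebCardinal N α).eval v : ℝ) : ℂ) =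
      1 / (2 * π) * μ.integral (fun ω : ℝ =>
        Complex.exp (Complex.I * ω * (u + v / 2 ^ m : ℝ)) -
        ∑ α, (chebCardinal N α).eval v •
          Complex.exp (Complex.I * ω * (u + chebNode N α / 2 ^ m : ℝ))) B := by
    have hi : ∀ α ∈ Finset.univ, μ.Integrable fun ω : ℝ => (chebCardinal N α).eval v •
        Complex.exp (Complex.I * ω * (u + chebNode N α / 2 ^ m : ℝ)) := fun α _ =>
      (hF.integrable_cexp _).smul ((chebCardinal N α).eval v)
    rw [VectorMeasure.integral_fun_sub (hF.integrable_cexp _) (integrable_finsetSum _ hi),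
      VectorMeasure.integral_finsetSum _ hi, mul_sub, Finset.mul_sum, Complex.ofReal_sub,
      hF.eq_integral, Complex.ofReal_sum]
    congr 1
    refine Finset.sum_congr rfl fun α _ => ?_
    rw [VectorMeasure.integral_fun_smul, Complex.ofReal_mul, hF.eq_integral, Complex.real_smul]
    ring
  have hbound : ‖μ.integral (fun ω : ℝ =>
        Complex.exp (Complex.I * ω * (u + v / 2 ^ m : ℝ)) -
        ∑ α, (chebCardinal N α).eval v •
          Complex.exp (Complex.I * ω * (u + chebNode N α / 2 ^ m : ℝ))) B‖ ≤
      C * ‖B‖ * μ.variation.real Set.univ :=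
    VectorMeasure.norm_integral_le_of_norm_le_const
      (hF.ae_abs_le.mono fun ω hω => norm_cexp_sub_cheb_le hN hω u hv)
  have hV : μ.variation.real Set.univ = totalVariationNorm μ := rfl
  have hpi := Real.pi_pos
  rw [← Real.norm_eq_abs, ← Complex.norm_real, heq, norm_mul]
  have h2 : ‖(1 / (2 * π) : ℂ)‖ = 1 / (2 * π) := by
    rw [show (1 / (2 * π) : ℂ) = ((1 / (2 * π) : ℝ) : ℂ) by push_cast; rfl, Complex.norm_real,
      Real.norm_of_nonneg (by positivity)]
  rw [h2]
  have hV0 : 0 ≤ totalVariationNorm μ := ENNReal.toReal_nonneg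
  calc _ ≤ 1 / (2 * π) * (C * 1 * totalVariationNorm μ) := by
        rw [← hV] at hV0 ⊢
        refine mul_le_mul_of_nonneg_left (hbound.trans ?_) (by positivity)
        gcongr
    _ = _ := by rw [hC]; field_simp; ring

end IsBandlimitedWith

/-! ### The maximal interpolation error -/

lemma add_div_two_pow_mem_Icc {m : ℕ} {u v : ℝ} (hu : u ∈ Set.Icc (0 : ℝ) (1 - 1 / 2 ^ m))
    (hv : v ∈ Set.Icc (0 : ℝ) 1) : u + v / 2 ^ m ∈ Set.Icc (0 : ℝ) 1 := by
  have h1 : v / 2 ^ m ≤ 1 / 2 ^ m := by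
    have := hv.2
    gcongr
  have h0 : 0 ≤ v / 2 ^ m := div_nonneg hv.1 (by positivity)
  exact ⟨by linarith [hu.1], by linarith [hu.2]⟩

lemma interpErrorSet_congr {m N : ℕ} {f F : ℝ → ℝ} (hf : Set.EqOn f F (Set.Icc 0 1)) :
    interpErrorSet m N f = interpErrorSet m N F := by
  ext e
  refine exists_congr fun u => and_congr_right fun hu => exists_congr fun v =>
    and_congr_right fun hv => ?_
  rw [hf (add_div_two_pow_mem_Icc hu hv), Finset.sum_congr rfl fun α _ => by
    rw [hf (add_div_two_pow_mem_Icc hu (chebNode_mem_Icc N α))]]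

lemma isGreatest_interpError {m N : ℕ} {f F : ℝ → ℝ} (hf : Set.EqOn f F (Set.Icc 0 1))
    (hF : Continuous F) : IsGreatest (interpErrorSet m N f) (interpError m N f) := by
  rw [interpError, interpErrorSet_congr hf]
  have himage : interpErrorSet m N F = (fun p : ℝ × ℝ => |F (p.1 + p.2 / 2 ^ m) -
      ∑ α : Fin (N + 1), F (p.1 + chebNode N α / 2 ^ m) * (chebCardinal N α).eval p.2|) ''
      (Set.Icc (0 : ℝ) (1 - 1 / 2 ^ m) ×ˢ Set.Icc (0 : ℝ) 1) := by
    ext e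
    constructor
    · rintro ⟨u, hu, v, hv, rfl⟩
      exact ⟨(u, v), ⟨hu, hv⟩, rfl⟩
    · rintro ⟨⟨u, v⟩, ⟨hu, hv⟩, rfl⟩
      exact ⟨u, hu, v, hv, rfl⟩
  rw [himage]
  have h1 : (1 : ℝ) / 2 ^ m ≤ 1 := by
    rw [div_le_one (by positivity)]
    exact one_le_pow₀ (by norm_num)
  refine IsCompact.isGreatest_sSup ((isCompact_Icc.prod isCompact_Icc).image ?_) ?_
  · have hP : ∀ α : Fin (N + 1), Continuous fun p : ℝ × ℝ => (chebCardinal N α).eval p.2 :=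
      fun α => (chebCardinal N α).continuous.comp continuous_snd
    fun_prop
  · exact Set.Nonempty.image _ ⟨(0, 0), ⟨⟨le_rfl, by linarith⟩, ⟨le_rfl, zero_le_one⟩⟩⟩

/-! ### Ranks of the quantized tensor -/

lemma dyadicPoint_mem_Icc {K : ℕ} (σ : Fin K → Fin 2) :
    dyadicPoint σ ∈ Set.Icc (0 : ℝ) (1 - 1 / 2 ^ K) := by
  refine ⟨Finset.sum_nonneg fun k _ => by positivity, ?_⟩
  induction K with
  | zero => simp [dyadicPoint]
  | succ K ih =>
    have h := ih fun k => σ k.castSucc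
    have h1 : ((σ (Fin.last K) : ℕ) : ℝ) ≤ 1 := by
      exact_mod_cast Nat.lt_succ_iff.1 (σ (Fin.last K)).isLt
    have hlast : ((σ (Fin.last K) : ℕ) : ℝ) / 2 ^ (K + 1) ≤ 1 / 2 ^ (K + 1) := by gcongr
    have hsplit : (1 : ℝ) / 2 ^ K = 1 / 2 ^ (K + 1) + 1 / 2 ^ (K + 1) := by
      rw [pow_succ]; field_simp; norm_num
    simp only [dyadicPoint] at h ⊢
    rw [Fin.sum_univ_castSucc]
    simp only [Fin.val_castSucc, Fin.val_last]
    linarith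

lemma dyadicPoint_mem_Icc_zero_one {K : ℕ} (σ : Fin K → Fin 2) :
    dyadicPoint σ ∈ Set.Icc (0 : ℝ) 1 :=
  Set.Icc_subset_Icc_right (sub_le_self _ (by positivity)) (dyadicPoint_mem_Icc σ)

lemma sum_fin_split {m n K : ℕ} (h : m + n = K) (g : Fin K → ℝ) :
    ∑ k, g k = ∑ i : Fin m, g (Fin.castLE (by omega) i) +
      ∑ j : Fin n, g ⟨m + (j : ℕ), by have := j.isLt; omega⟩ := by
  subst h
  exact Fin.sum_univ_add g

lemma dyadicPoint_split {m K : ℕ} (hm : m ≤ K) (σ : Fin K → Fin 2) :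
    dyadicPoint σ = dyadicPoint (fun i : Fin m => σ (Fin.castLE hm i)) +
      dyadicPoint (fun j : Fin (K - m) => σ ⟨m + (j : ℕ), by have := j.isLt; omega⟩) / 2 ^ m := by
  simp only [dyadicPoint]
  rw [sum_fin_split (Nat.add_sub_of_le hm), Finset.sum_div]
  congr 1
  refine Finset.sum_congr rfl fun j _ => ?_
  rw [div_div, ← pow_add]
  congr 2
  dsimp only
  ring

/-- Splitting a dyadic point as `u + 2⁻ᵐ v`, with `u` and `v` given by the two groups of digits,
turns the interpolation formula into a sum of `N + 1` tensor products. -/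
theorem succ_mem_unfoldingApproxRanks {m K N : ℕ} (hm : m ≤ K) {ε : ℝ} (hε : 0 ≤ ε) {f : ℝ → ℝ}
    (h : ∀ e ∈ interpErrorSet m N f, e ≤ ε) :
    N + 1 ∈ unfoldingApproxRanks hm ε (quantizedTensor K f) := by
  refine ⟨fun α τ => f (dyadicPoint τ + chebNode N α / 2 ^ m),
    fun α ρ => (chebCardinal N α).eval (dyadicPoint ρ), ?_⟩
  rw [pi_norm_le_iff_of_nonneg hε]
  intro σ
  rw [Pi.sub_apply, Finset.sum_apply, Real.norm_eq_abs, quantizedTensor, dyadicPoint_split hm σ]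
  exact h _ ⟨_, dyadicPoint_mem_Icc _, _, dyadicPoint_mem_Icc_zero_one _, rfl⟩

lemma mul_exp_le_of_posLog_le {b ε A N : ℝ} (hb : 0 ≤ b) (hε : 0 < ε)
    (hN : A + 2 * Real.posLog (b / ε) ≤ N) : b * Real.exp ((A - N) / 2) ≤ ε := by
  have hle : b / ε ≤ Real.exp (Real.posLog (b / ε)) := by
    rw [Real.posLog_eq_log_max_one (by positivity), Real.exp_log (by positivity)]
    exact le_max_right _ _
  calc b * Real.exp ((A - N) / 2)
      ≤ (Real.exp (Real.posLog (b / ε)) * ε) * Real.exp (-Real.posLog (b / ε)) := by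
        gcongr
        · exact (div_le_iff₀ hε).1 hle
        · linarith
    _ = ε := by
        rw [mul_right_comm, ← Real.exp_add, add_neg_cancel, Real.exp_zero, one_mul]

theorem mainTheorem2 (Ω : ℝ) (F : ℝ → ℝ) (μ : ComplexMeasure ℝ)
    (hF : IsBandlimitedWith Ω F μ) (f : ℝ → ℝ) (hf : Set.EqOn f F (Set.Icc 0 1)) (m : ℕ) :
    (∀ N : ℕ, 1 ≤ N →
      IsGreatest (interpErrorSet m N f) (interpError m N f) ∧
      interpError m N f ≤
        2 * totalVariationNorm μ / π * Real.exp ((Ω / 2 ^ m - N) / 2)) ∧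
    (∀ (K : ℕ) (hm : m < K) (ε : ℝ), 0 < ε →
      IsLeast (unfoldingApproxRanks hm.le ε (quantizedTensor K f))
        (unfoldingRank hm.le ε (quantizedTensor K f)) ∧
      unfoldingRank hm.le ε (quantizedTensor K f) ≤
        1 + ⌈Ω / 2 ^ m + 2 * Real.posLog (2 * totalVariationNorm μ / (π * ε))⌉₊) := by
  have herr : ∀ N : ℕ, 1 ≤ N → ∀ e ∈ interpErrorSet m N f,
      e ≤ 2 * totalVariationNorm μ / π * Real.exp ((Ω / 2 ^ m - N) / 2) := by
    intro N hN e he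
    rw [interpErrorSet_congr hf] at he
    obtain ⟨u, -, v, hv, rfl⟩ := he
    exact hF.abs_sub_cheb_le hN u hv
  constructor
  · intro N hN
    have hmax := isGreatest_interpError (m := m) (N := N) hf hF.continuous
    exact ⟨hmax, herr N hN _ hmax.1⟩
  · intro K hm ε hε
    have hV : 0 ≤ totalVariationNorm μ := ENNReal.toReal_nonneg
    have hΩ := hF.bandwidth_pos
    set X := Ω / 2 ^ m + 2 * Real.posLog (2 * totalVariationNorm μ / (π * ε)) with hX
    have hXpos : 0 < X := by
      have := Real.posLog_nonneg (x := 2 * totalVariationNorm μ / (π * ε))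
      positivity
    have hmem : ⌈X⌉₊ + 1 ∈ unfoldingApproxRanks hm.le ε (quantizedTensor K f) := by
      refine succ_mem_unfoldingApproxRanks hm.le hε.le fun e he =>
        (herr _ (Nat.ceil_pos.2 hXpos) e he).trans ?_
      refine mul_exp_le_of_posLog_le (by positivity) hε ?_
      rw [div_div]
      exact Nat.le_ceil X
    refine ⟨⟨Nat.sInf_mem ⟨_, hmem⟩, fun r hr => Nat.sInf_le hr⟩, ?_⟩
    rw [add_comm]
    exact Nat.sInf_le hmem
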